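/- **Conventions.** A *subproduct system of Hilbert spaces over $\mathbb N=\{0,1,2,\dots\}$* is a sequence $X=\{X(n)\}_{n\ge 0}$ of complex Hilbert spaces (of arbitrary dimension) with $X(0)=\mathbb C$, together with coisometric maps $U_{m,n}:X(m)\otimes X(n)\to X(m+n)$ such that $U_{0,n}$ and $U_{n,0}$ are scalar multiplication and $U_{m+n,k}(U_{m,n}\otimes I)=U_{m,n+k}(I\otimes U_{n,k})$. Each $X(n)$ carries its operator space structure as a Hilbert $C^*$-module over $\mathbb C$ (column Hilbert space), i.e. $\|(x_{ij})\|^2=\big\|\big(\sum_k\langle x_{ki},x_{kj}\rangle\big)_{i,j}\big\|$. A *completely bounded representation* of $X$ on a Hilbert space $H$ is a family $T=\{T_n\}$ of completely bounded linear maps $T_n:X(n)\to B(H)$ with $T_0(c)=cI_H$ and $T_{m+n}(U_{m,n}(x\otimes y))=T_m(x)T_n(y)$. It is generated by $T_1$, and $\|T\|_{cb}$ denotes the completely bounded norm of $T_1:X(1)\to B(H)$ (equivalently, the norm of the row operator $(T_1(e_i))_i$ for an orthonormal basis $(e_i)$ of $X(1)$). For a family $T=\{T_n\}$ of linear maps $T_n:X(n)\to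 B(L)$ write $\widetilde T_n:X(n)\otimes L\to L$ for the bounded operator with $\widetilde T_n(x\otimes h)=T_n(x)h$, when it exists. If $M\subseteq L$ is a closed subspace and $S=\{S_n\}$ is a family of linear maps $S_n:X(n)\to B(M)$, then $S$ is a *piece* of $T$ if for all $n$ the operators $\widetilde S_n$ and $\widetilde T_n$ exist, $\widetilde T_n^*M\subseteq X(n)\otimes M$ and $\widetilde T_n^*|_M=\widetilde S_n^*$. The *shift* $S^X$ is the representation of $X$ on $\mathfrak F_X=\bigoplus_{n\ge0}X(n)$ given by $S^X(x)y=U_{m,n}(x\otimes y)$ for $x\in X(m)$, $y\in X(n)$. For a Hilbert space $K$ and $r>0$, $S^X\otimes rI_K$ denotes the family on $\mathfrak F_X\otimes K$ generated by $e\mapsto S^X(e)\otimes rI_K$, $e\in X(1)$; that is, $x\mapsto S^X(x)\otimes r^nI_K$ for $x\in X(n)$. **Theorem.** Let $X$ be a subproduct system of Hilbert spaces over $\mathbb N$, let $T$ be a completely bounded representation of $X$ on a separable Hilbert space $H$, and let $K$ be an infinite-dimensional separable Hilbert space. Then for every $r>\|T\|_{cb}$, $T$ is unitarily equivalent to a piece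 of $S^X\otimes rI_K$. Moreover, $\|T\|_{cb}$ is the infimum of the set of all $r>0$ such that $T$ is unitarily equivalent to a piece of $S^X\otimes rI_K$. -/

import Mathlib

open scoped TensorProduct

noncomputable section

/-! ### Hilbert space tensor products -/

/-- The Hilbert space tensor product `E ⊗ F`: the completion of the algebraic tensor product in
the inner product `⟪a ⊗ b, c ⊗ d⟫ = ⟪a, c⟫ * ⟪b, d⟫`. -/
abbrev HTensor (E F : Type*) [NormedAddCommGroup E] [InnerProductSpace ℂ E]
    [NormedAddCommGroup F] [InnerProductSpace ℂ F] : Type _ :=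
  UniformSpace.Completion (E ⊗[ℂ] F)

namespace HTensor

variable {E F G : Type*} [NormedAddCommGroup E] [InnerProductSpace ℂ E]
  [NormedAddCommGroup F] [InnerProductSpace ℂ F] [NormedAddCommGroup G] [InnerProductSpace ℂ G]

/-- The elementary tensor `x ⊗ y` in the Hilbert space tensor product. -/
def tmul (x : E) (y : F) : HTensor E F := ((x ⊗ₜ[ℂ] y : E ⊗[ℂ] F) : HTensor E F)

lemma norm_tmul (x : E) (y : F) : ‖tmul x y‖ = ‖x‖ * ‖y‖ := by
  simp [tmul, UniformSpace.Completion.norm_coe, TensorProduct.norm_tmul]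

lemma tmul_add (x : E) (y z : F) : tmul x (y + z) = tmul x y + tmul x z := by
  simp [tmul, TensorProduct.tmul_add, UniformSpace.Completion.coe_add]

lemma add_tmul (x y : E) (z : F) : tmul (x + y) z = tmul x z + tmul y z := by
  simp [tmul, TensorProduct.add_tmul, UniformSpace.Completion.coe_add]

lemma tmul_smul (c : ℂ) (x : E) (y : F) : tmul x (c • y) = c • tmul x y := by
  simp [tmul, TensorProduct.tmul_smul, UniformSpace.Completion.coe_smul]

lemma smul_tmul (c : ℂ) (x : E) (y : F) : tmul (c • x) y = c • tmul x y := by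
  rw [tmul, ← TensorProduct.smul_tmul', UniformSpace.Completion.coe_smul, tmul]

/-- `I_E ⊗ V` for an isometry `V : F → G`. -/
def lmapIsometry (E : Type*) [NormedAddCommGroup E] [InnerProductSpace ℂ E] (V : F →ₗᵢ[ℂ] G) :
    HTensor E F →L[ℂ] HTensor E G :=
  (V.lTensor E).toContinuousLinearMap.completion

/-- Every element of the algebraic tensor product is a finite sum `∑ x j ⊗ f j` with the `f j`
orthonormal. -/
lemma exists_orthonormal_repr (t : E ⊗[ℂ] F) :
    ∃ (n : ℕ) (f : Fin n → F) (x : Fin n → E), Orthonormal ℂ f ∧ t = ∑ j, x j ⊗ₜ[ℂ] f j := by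
  obtain ⟨E', F', iE', iF', hz⟩ :=
    TensorProduct.exists_finite_submodule_of_setFinite {t} (Set.finite_singleton t)
  obtain ⟨y, rfl⟩ := Set.singleton_subset_iff.mp hz
  let f := stdOrthonormalBasis ℂ F'
  have key : ∀ y : E' ⊗[ℂ] F', ∃ c : Fin (Module.finrank ℂ F') → E', y = ∑ j, c j ⊗ₜ[ℂ] f j := by
    intro y
    induction y with
    | zero => exact ⟨0, by simp⟩
    | tmul a b =>
      refine ⟨fun j => (f.repr b j) • a, ?_⟩
      conv_lhs => rw [← f.sum_repr b]
      simp [TensorProduct.tmul_sum, TensorProduct.smul_tmul]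
    | add u v hu hv =>
      obtain ⟨c, rfl⟩ := hu
      obtain ⟨d, rfl⟩ := hv
      exact ⟨c + d, by simp [TensorProduct.add_tmul, Finset.sum_add_distrib]⟩
  obtain ⟨c, rfl⟩ := key y
  refine ⟨_, fun j => (f j : F), fun j => (c j : E), ?_, ?_⟩
  · exact f.orthonormal.comp_linearIsometry F'.subtypeₗᵢ
  · simp [TensorProduct.mapIncl]

lemma norm_sq_sum_tmul {n : ℕ} {f : Fin n → F} (hf : Orthonormal ℂ f) (x : Fin n → E) :
    ‖∑ j, x j ⊗ₜ[ℂ] f j‖ ^ 2 = ∑ j, ‖x j‖ ^ 2 := by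
  have h : (inner ℂ (∑ j, x j ⊗ₜ[ℂ] f j) (∑ j, x j ⊗ₜ[ℂ] f j) : ℂ) =
      ((∑ j, ‖x j‖ ^ 2 : ℝ) : ℂ) := by
    simp only [sum_inner, inner_sum, TensorProduct.inner_tmul]
    simp [orthonormal_iff_ite.mp hf, inner_self_eq_norm_sq_to_K]
  have h' := inner_self_eq_norm_sq_to_K (𝕜 := ℂ) (∑ j, x j ⊗ₜ[ℂ] f j)
  rw [h'] at h
  apply Complex.ofReal_injective
  rw [Complex.ofReal_pow]
  exact h

lemma norm_rTensor_le (A : E →L[ℂ] G) (t : E ⊗[ℂ] F) :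
    ‖LinearMap.rTensor F (A : E →ₗ[ℂ] G) t‖ ≤ ‖A‖ * ‖t‖ := by
  obtain ⟨n, f, x, hf, rfl⟩ := exists_orthonormal_repr t
  refine le_of_sq_le_sq ?_ (by positivity)
  rw [mul_pow, norm_sq_sum_tmul hf, map_sum]
  simp only [LinearMap.rTensor_tmul]
  rw [norm_sq_sum_tmul hf, Finset.mul_sum]
  refine Finset.sum_le_sum fun j _ => ?_
  rw [← mul_pow]
  exact pow_le_pow_left₀ (norm_nonneg _) (A.le_opNorm _) 2

/-- `A ⊗ I_K`, the bounded operator with `(A ⊗ I_K) (x ⊗ k) = A x ⊗ k`. -/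
def ampl (K : Type*) [NormedAddCommGroup K] [InnerProductSpace ℂ K] (A : E →L[ℂ] G) :
    HTensor E K →L[ℂ] HTensor G K :=
  ((LinearMap.rTensor K (A : E →ₗ[ℂ] G)).mkContinuous ‖A‖ (norm_rTensor_le A)).completion

lemma ampl_coe (K : Type*) [NormedAddCommGroup K] [InnerProductSpace ℂ K] (A : E →L[ℂ] G)
    (t : E ⊗[ℂ] K) : ampl K A (t : HTensor E K) =
      ((LinearMap.rTensor K (A : E →ₗ[ℂ] G) t : G ⊗[ℂ] K) : HTensor G K) := by
  simp [ampl]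

lemma ampl_add (K : Type*) [NormedAddCommGroup K] [InnerProductSpace ℂ K] (A B : E →L[ℂ] G) :
    ampl K (A + B) = ampl K A + ampl K B := by
  ext u
  induction u using UniformSpace.Completion.induction_on with
  | hp => exact isClosed_eq (ampl K (A + B)).continuous (ampl K A + ampl K B).continuous
  | ih t =>
    rw [_root_.add_apply, ampl_coe, ampl_coe, ampl_coe, ← UniformSpace.Completion.coe_add]
    simp [LinearMap.rTensor_add]

lemma ampl_smul (K : Type*) [NormedAddCommGroup K] [InnerProductSpace ℂ K] (c : ℂ)
    (A : E →L[ℂ] G) : ampl K (c • A) = c • ampl K A := by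
  ext u
  induction u using UniformSpace.Completion.induction_on with
  | hp => exact isClosed_eq (ampl K (c • A)).continuous (c • ampl K A).continuous
  | ih t =>
    rw [_root_.smul_apply, ampl_coe, ampl_coe, ← UniformSpace.Completion.coe_smul]
    simp [LinearMap.rTensor_smul]

end HTensor

/-! ### Complete boundedness -/

section CompletelyBounded

/-- The operator on `V ⊕ ⋯ ⊕ V` (Hilbert space direct sum) with operator matrix `A`;
this is the identification `M_N(B(V, W)) = B(V^N, W^N)`. -/
def blockOp {V W : Type*} [NormedAddCommGroup V] [InnerProductSpace ℂ V]
    [NormedAddCommGroup W] [InnerProductSpace ℂ W] {N : ℕ} (A : Matrix (Fin N) (Fin N) (V →L[ℂ] W)) :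
    PiLp 2 (fun _ : Fin N => V) →L[ℂ] PiLp 2 (fun _ : Fin N => W) :=
  (PiLp.continuousLinearEquiv 2 ℂ (fun _ : Fin N => W)).symm.toContinuousLinearMap ∘L
    ContinuousLinearMap.pi fun i => ∑ j, A i j ∘L PiLp.proj 2 (fun _ : Fin N => V) j

variable {E H : Type*} [NormedAddCommGroup E] [InnerProductSpace ℂ E]
  [NormedAddCommGroup H] [InnerProductSpace ℂ H]

/-- The norm of `M_N(E)` for the operator space structure that a Hilbert space `E` carries as a
Hilbert C*-module over `ℂ`, namely `E = B(ℂ, E)`: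
the square of the norm of `(x i j)` is the norm of the matrix `(∑ k, ⟪x k i, x k j⟫)`. -/
def columnMatrixNorm {N : ℕ} (x : Matrix (Fin N) (Fin N) E) : ℝ :=
  ‖blockOp (x.map fun e => ContinuousLinearMap.toSpanSingleton ℂ e)‖

/-- All the matrix amplifications `M_N(E) → M_N(B(H))` of `T : E → B(H)` are bounded by `C`. -/
def IsCBBound (T : E →ₗ[ℂ] (H →L[ℂ] H)) (C : ℝ) : Prop :=
  ∀ (N : ℕ) (x : Matrix (Fin N) (Fin N) E), ‖blockOp (x.map T)‖ ≤ C * columnMatrixNorm x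

/-- `T : E → B(H)` is completely bounded. -/
def IsCompletelyBounded (T : E →ₗ[ℂ] (H →L[ℂ] H)) : Prop := ∃ C : ℝ, IsCBBound T C

/-- The completely bounded norm of `T : E → B(H)`. -/
def cbNorm (T : E →ₗ[ℂ] (H →L[ℂ] H)) : ℝ := sInf {C : ℝ | 0 ≤ C ∧ IsCBBound T C}

/-- `Tt` is the operator `E ⊗ H → H`, `x ⊗ h ↦ T(x) h` associated with `T : E → B(H)`. -/
def IsTilde (T : E →ₗ[ℂ] (H →L[ℂ] H)) (Tt : HTensor E H →L[ℂ] H) : Prop :=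
  ∀ (x : E) (h : H), Tt (HTensor.tmul x h) = T x h

end CompletelyBounded

/-! ### Subproduct systems of Hilbert spaces over `ℕ` -/

/-- A subproduct system structure on a sequence `X` of Hilbert spaces: `X 0` is `ℂ`, and there are
associative coisometric maps `U : X m ⊗ X n → X (m + n)` for which `U` with an index `0` is scalar
multiplication. To avoid transports along `(l + m) + n = l + (m + n)`, the target of `U` is
written `X k` with a proof of `m + n = k`. -/
structure SubproductSystem (X : ℕ → Type*) [∀ n, NormedAddCommGroup (X n)]
    [∀ n, InnerProductSpace ℂ (X n)] [∀ n, CompleteSpace (X n)] where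
  /-- the identification of `X 0` with `ℂ` -/
  scalar : ℂ ≃ₗᵢ[ℂ] X 0
  /-- the multiplication maps -/
  U : ∀ {m n k : ℕ}, m + n = k → (HTensor (X m) (X n) →L[ℂ] X k)
  coisometric : ∀ {m n k : ℕ} (h : m + n = k),
    U h ∘L ContinuousLinearMap.adjoint (U h) = ContinuousLinearMap.id ℂ (X k)
  U_scalar_left : ∀ {n : ℕ} (c : ℂ) (x : X n),
    U (Nat.zero_add n) (HTensor.tmul (scalar c) x) = c • x
  U_scalar_right : ∀ {n : ℕ} (c : ℂ) (x : X n),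
    U (Nat.add_zero n) (HTensor.tmul x (scalar c)) = c • x
  assoc : ∀ {l m n p q k : ℕ} (hlm : l + m = p) (hpn : p + n = k) (hmn : m + n = q)
    (hlq : l + q = k) (x : X l) (y : X m) (z : X n),
    U hpn (HTensor.tmul (U hlm (HTensor.tmul x y)) z) =
      U hlq (HTensor.tmul x (U hmn (HTensor.tmul y z)))

namespace SubproductSystem

variable {X : ℕ → Type*} [∀ n, NormedAddCommGroup (X n)] [∀ n, InnerProductSpace ℂ (X n)]
  [∀ n, CompleteSpace (X n)] (P : SubproductSystem X)

lemma norm_U_tmul_le {m n k : ℕ} (h : m + n = k) (x : X m) (y : X n) :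
    ‖P.U h (HTensor.tmul x y)‖ ≤ ‖x‖ * ‖y‖ := by
  have h1 : ‖ContinuousLinearMap.adjoint (P.U h)‖ * ‖ContinuousLinearMap.adjoint (P.U h)‖ ≤ 1 := by
    rw [← ContinuousLinearMap.norm_adjoint_comp_self, ContinuousLinearMap.adjoint_adjoint,
      P.coisometric h]
    exact ContinuousLinearMap.norm_id_le
  rw [LinearIsometryEquiv.norm_map] at h1
  have h2 : ‖P.U h‖ ≤ 1 := by nlinarith [norm_nonneg (P.U h)]
  calc _ ≤ ‖P.U h‖ * ‖HTensor.tmul x y‖ := (P.U h).le_opNorm _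
    _ ≤ 1 * ‖HTensor.tmul x y‖ := by gcongr
    _ = ‖x‖ * ‖y‖ := by rw [one_mul, HTensor.norm_tmul]

/-- The Fock space `⨁ X n` (Hilbert space direct sum). -/
abbrev Fock (_P : SubproductSystem X) : Type _ := lp X 2

/-- The sequence `S(x) ξ`: its component in `X (m + n)` is `U (x ⊗ ξ n)`, and its components in
`X k` with `k < m` vanish. -/
def shiftFun {m : ℕ} (x : X m) (ξ : ∀ n, X n) (k : ℕ) : X k :=
  if h : m ≤ k then P.U (Nat.add_sub_of_le h) (HTensor.tmul x (ξ (k - m))) else 0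

lemma shiftFun_add {m : ℕ} (x : X m) (ξ : ∀ n, X n) (n : ℕ) :
    P.shiftFun x ξ (m + n) = P.U rfl (HTensor.tmul x (ξ n)) := by
  have key : ∀ (j : ℕ) (hj : m + j = m + n), j = n →
      P.U hj (HTensor.tmul x (ξ j)) = P.U rfl (HTensor.tmul x (ξ n)) := by
    rintro j hj rfl
    rfl
  rw [shiftFun, dif_pos (Nat.le_add_right m n)]
  exact key _ _ (by omega)

lemma shiftFun_of_lt {m : ℕ} (x : X m) (ξ : ∀ n, X n) {k : ℕ} (h : k < m) :
    P.shiftFun x ξ k = 0 := by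
  rw [shiftFun, dif_neg (by omega)]

lemma shiftFun_bound {m : ℕ} (x : X m) (ξ : lp X 2) :
    Summable (fun k => ‖P.shiftFun x ξ k‖ ^ 2) ∧
      ∑' k, ‖P.shiftFun x ξ k‖ ^ 2 ≤ (‖x‖ * ‖ξ‖) ^ 2 := by
  have hs : HasSum (fun n => ‖ξ n‖ ^ 2) (‖ξ‖ ^ 2) := by
    have := lp.hasSum_norm (p := 2) (by norm_num) ξ
    simpa using this
  have hb : ∀ n, ‖P.shiftFun x ξ (n + m)‖ ^ 2 ≤ ‖x‖ ^ 2 * ‖ξ n‖ ^ 2 := by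
    intro n
    rw [Nat.add_comm n m, shiftFun_add, ← mul_pow]
    exact pow_le_pow_left₀ (norm_nonneg _) (P.norm_U_tmul_le _ _ _) 2
  have hs' := hs.mul_left (‖x‖ ^ 2)
  have h1 : Summable (fun n => ‖P.shiftFun x ξ (n + m)‖ ^ 2) :=
    Summable.of_nonneg_of_le (fun _ => by positivity) hb hs'.summable
  have h2 : Summable (fun k => ‖P.shiftFun x ξ k‖ ^ 2) := (summable_nat_add_iff m).mp h1
  refine ⟨h2, ?_⟩
  rw [← h2.sum_add_tsum_nat_add m, Finset.sum_eq_zero, zero_add, mul_pow, ← hs'.tsum_eq]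
  · exact h1.tsum_le_tsum hb hs'.summable
  · intro k hk
    rw [P.shiftFun_of_lt x ξ (Finset.mem_range.mp hk)]
    simp

/-- The vector `S(x) ξ` of the Fock space. -/
def shiftVec {m : ℕ} (x : X m) (ξ : P.Fock) : P.Fock :=
  ⟨P.shiftFun x ξ, memℓp_gen (by simpa using (P.shiftFun_bound x ξ).1)⟩

lemma norm_shiftVec_le {m : ℕ} (x : X m) (ξ : P.Fock) : ‖P.shiftVec x ξ‖ ≤ ‖x‖ * ‖ξ‖ := by
  refine le_of_sq_le_sq ?_ (by positivity)
  have h := (lp.hasSum_norm (p := 2) (by norm_num) (P.shiftVec x ξ)).tsum_eq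
  have h' : ‖P.shiftVec x ξ‖ ^ 2 = ∑' k, ‖P.shiftFun x ξ k‖ ^ 2 := by
    simpa [shiftVec] using h.symm
  rw [h']
  exact (P.shiftFun_bound x ξ).2

/-- A family of linear maps `T n : X n → B(H)`, one on each fibre. -/
abbrev Family (_P : SubproductSystem X) (H : Type*) [NormedAddCommGroup H]
    [InnerProductSpace ℂ H] : Type _ :=
  ∀ n, X n →ₗ[ℂ] (H →L[ℂ] H)

/-- The shift representation on the Fock space, `S(x) y = U (x ⊗ y)`. -/
def shift : P.Family P.Fock := fun m =>
  { toFun := fun x =>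
      LinearMap.mkContinuous
        { toFun := P.shiftVec x
          map_add' := fun ξ η => by
            ext k
            simp only [shiftVec, shiftFun, lp.coeFn_add, Pi.add_apply]
            split_ifs <;> simp [HTensor.tmul_add]
          map_smul' := fun c ξ => by
            ext k
            simp only [shiftVec, shiftFun, lp.coeFn_smul, Pi.smul_apply, RingHom.id_apply]
            split_ifs <;> simp [HTensor.tmul_smul] }
        ‖x‖ (P.norm_shiftVec_le x)
    map_add' := fun x y => by
      ext ξ k
      simp only [LinearMap.mkContinuous_apply, LinearMap.coe_mk, AddHom.coe_mk,
        _root_.add_apply, shiftVec, shiftFun, lp.coeFn_add, Pi.add_apply]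
      split_ifs <;> simp [HTensor.add_tmul]
    map_smul' := fun c x => by
      ext ξ k
      simp only [LinearMap.mkContinuous_apply, LinearMap.coe_mk, AddHom.coe_mk,
        _root_.smul_apply, shiftVec, shiftFun, lp.coeFn_smul, Pi.smul_apply,
        RingHom.id_apply]
      split_ifs <;> simp [HTensor.smul_tmul] }

/-- `S ⊗ rI_K`, the scaled inflation of the shift: the family on `Fock ⊗ K` that is
`e ↦ S(e) ⊗ rI_K` on `X 1`, and hence (being multiplicative) `x ↦ S(x) ⊗ r ^ n I_K` on `X n`. -/
def scaledInflation (K : Type*) [NormedAddCommGroup K] [InnerProductSpace ℂ K] (r : ℝ) :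
    P.Family (HTensor P.Fock K) := fun n =>
  { toFun := fun x => ((r : ℂ) ^ n) • HTensor.ampl K (P.shift n x)
    map_add' := fun x y => by rw [map_add, HTensor.ampl_add, smul_add]
    map_smul' := fun c x => by
      rw [map_smul, HTensor.ampl_smul, smul_comm, RingHom.id_apply] }

variable {H L : Type*} [NormedAddCommGroup H] [InnerProductSpace ℂ H]
  [NormedAddCommGroup L] [InnerProductSpace ℂ L]

/-- `T` is a completely bounded representation of the subproduct system on `H`: it is completely
bounded on every fibre, multiplicative, and its restriction to `X 0 = ℂ` is the (only)
nondegenerate representation `c ↦ c I` of `ℂ` on `H`. -/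
structure IsCBRepresentation (T : P.Family H) : Prop where
  completelyBounded : ∀ n, IsCompletelyBounded (T n)
  scalar : ∀ c : ℂ, T 0 (P.scalar c) = c • ContinuousLinearMap.id ℂ H
  mul : ∀ {m n k : ℕ} (h : m + n = k) (x : X m) (y : X n),
    T k (P.U h (HTensor.tmul x y)) = T m x ∘L T n y

/-- For a closed subspace `M` of `L` and families `S` on `M` and `T` on `L`: `S` is a piece of `T`,
that is, `T̃ₙ* M ⊆ X n ⊗ M` and `T̃ₙ*` restricted to `M` is `S̃ₙ*` for every `n`. -/
def IsPiece [CompleteSpace L] (M : Submodule ℂ L) [CompleteSpace M]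
    (S : P.Family M) (T : P.Family L) : Prop :=
  ∀ n, ∃ (St : HTensor (X n) M →L[ℂ] M) (Tt : HTensor (X n) L →L[ℂ] L),
    IsTilde (S n) St ∧ IsTilde (T n) Tt ∧
      ∀ h : M, ContinuousLinearMap.adjoint Tt (h : L) =
        HTensor.lmapIsometry (X n) M.subtypeₗᵢ (ContinuousLinearMap.adjoint St h)

/-- The family `T` on `H` is unitarily equivalent to a piece of the family `R` on `L`. -/
def IsUnitarilyEquivalentToPiece [CompleteSpace L] (T : P.Family H) (R : P.Family L) : Prop :=
  ∃ (M : Submodule ℂ L) (_ : CompleteSpace M) (S : P.Family M) (W : H ≃ₗᵢ[ℂ] M),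
    P.IsPiece M S R ∧ ∀ n (x : X n) (h : H), W (T n x h) = S n x (W h)

/-- The completely bounded norm of a representation `T`, which is the completely bounded norm of
the map `T 1` on `X 1` that generates it; for an orthonormal basis `(eᵢ)` of `X 1` it is the norm of
the row operator `(T(eᵢ))ᵢ`. -/
def repCBNorm (T : P.Family H) : ℝ := cbNorm (T 1)

end SubproductSystem

end

/-!
The proof is a Poisson kernel argument. Write `T̃ₙ : X n ⊗ H → H` for the operator of `T` on `X n`.
On a column Hilbert space, complete boundedness of `x ↦ T x` with constant `C` is the same as
`‖T̃‖ ≤ C` (`isCBBound_iff_isRowBound`), so `‖T‖_cb = ‖T̃₁‖`.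

For `r > ‖T‖_cb` put `A n = r⁻ⁿ T n`, so that `‖Ã₁‖ < 1`. The coisometries of the subproduct system
give `‖Ãₙ‖ ≤ ‖Ã₁‖ⁿ` and `Ãₙ (I ⊗ Ã₁ Ã₁*) Ãₙ* = Ãₙ₊₁ Ãₙ₊₁*` (`tilde_comp_adjoint`). Since `H` is
separable and `K` is infinite-dimensional, `I - Ã₁ Ã₁* = B B*` for some `B : K → H`
(`exists_defect`). The operator `V (ξ ⊗ k) = ∑ A n (ξ n) B k` on `𝔉 ⊗ K` is bounded because the sum
is dominated by a geometric series, and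
`V V* = ∑ Ãₙ (I ⊗ B B*) Ãₙ* = ∑ (Ãₙ Ãₙ* - Ãₙ₊₁ Ãₙ₊₁*) = I` (`poisson_coisometric`).
Moreover `V (S x ⊗ I) = A n x V` for `x` in `X n` (`fockTilde_shift`), so `V*` is an isometry whose
range is co-invariant for `S ⊗ rI` and on which the compression is `T`
(`isUnitarilyEquivalentToPiece_of_coisometry`).

Conversely, the operator of the shift on `X 1` is a contraction, so that of `S ⊗ rI` has norm at
most `r`; passing to a piece restricts the adjoint, which does not increase the norm
(`isRowBound_of_isUnitarilyEquivalentToPiece`).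
-/

/-! ### Operators on Hilbert space tensor products -/

namespace HTensor

variable {E F G L : Type*} [NormedAddCommGroup E] [InnerProductSpace ℂ E]
  [NormedAddCommGroup F] [InnerProductSpace ℂ F] [NormedAddCommGroup G] [InnerProductSpace ℂ G]
  [NormedAddCommGroup L] [InnerProductSpace ℂ L]

lemma inner_tmul (x x' : E) (y y' : F) :
    inner ℂ (tmul x y) (tmul x' y') = inner ℂ x x' * inner ℂ y y' := by
  simp [tmul, UniformSpace.Completion.inner_coe, TensorProduct.inner_tmul]

lemma ampl_tmul (A : E →L[ℂ] G) (x : E) (y : F) : ampl F A (tmul x y) = tmul (A x) y := by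
  rw [tmul, ampl_coe]; simp [tmul]

lemma norm_ampl_le (A : E →L[ℂ] G) : ‖ampl F A‖ ≤ ‖A‖ := by
  refine ContinuousLinearMap.opNorm_le_bound _ (norm_nonneg _) fun u => ?_
  induction u using UniformSpace.Completion.induction_on with
  | hp => exact isClosed_le (ampl F A).continuous.norm (continuous_const.mul continuous_norm)
  | ih t =>
    rw [ampl_coe, UniformSpace.Completion.norm_coe, UniformSpace.Completion.norm_coe]
    exact norm_rTensor_le A t

/-- A bounded operator on `E ⊗ F` is determined by its values on elementary tensors. -/
lemma clm_ext {A B : HTensor E F →L[ℂ] G} (h : ∀ x y, A (tmul x y) = B (tmul x y)) : A = B := by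
  ext u
  induction u using UniformSpace.Completion.induction_on with
  | hp => exact isClosed_eq A.continuous B.continuous
  | ih t =>
    induction t with
    | zero => rw [UniformSpace.Completion.coe_zero, map_zero, map_zero]
    | tmul x y => exact h x y
    | add s t hs ht => rw [UniformSpace.Completion.coe_add, map_add, map_add, hs, ht]

/-- `x ⊗ ·` as a bounded operator `F → E ⊗ F`. -/
noncomputable def tmulLeft (F : Type*) [NormedAddCommGroup F] [InnerProductSpace ℂ F] :
    E →ₗ[ℂ] (F →L[ℂ] HTensor E F) where
  toFun x := LinearMap.mkContinuous
    { toFun := tmul x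
      map_add' := tmul_add x
      map_smul' := fun c y => tmul_smul c x y } ‖x‖ (fun y => (norm_tmul x y).le)
  map_add' x y := by ext; simp [add_tmul]
  map_smul' c x := by ext; simp [smul_tmul]

@[simp] lemma tmulLeft_apply (x : E) (y : F) : tmulLeft F x y = tmul x y := rfl

/-- `· ⊗ y` as a bounded operator `E → E ⊗ F`. -/
noncomputable def tmulRight (E : Type*) [NormedAddCommGroup E] [InnerProductSpace ℂ E] (y : F) :
    E →L[ℂ] HTensor E F :=
  LinearMap.mkContinuous
    { toFun := fun x => tmul x y
      map_add' := fun x x' => add_tmul x x' y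
      map_smul' := fun c x => smul_tmul c x y } ‖y‖
    (fun x => (norm_tmul x y).le.trans (mul_comm _ _).le)

/-- The row operators `(f (x j))ⱼ` with orthonormal `x` all have norm at most `C`. Only finite
families occur; this is boundedness by `C` of `x ⊗ y ↦ f x y` on the algebraic tensor product. -/
def IsRowBound (f : E →ₗ[ℂ] (F →L[ℂ] G)) (C : ℝ) : Prop :=
  ∀ (N : ℕ) (x : Fin N → E), Orthonormal ℂ x → ∀ h : Fin N → F,
    ‖∑ j, f (x j) (h j)‖ ^ 2 ≤ C ^ 2 * ∑ j, ‖h j‖ ^ 2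

/-- Every element of the algebraic tensor product is a finite sum `∑ x j ⊗ f j` with the `x j`
orthonormal. -/
lemma exists_orthonormal_left_repr (t : E ⊗[ℂ] F) :
    ∃ (n : ℕ) (x : Fin n → E) (f : Fin n → F), Orthonormal ℂ x ∧ t = ∑ j, x j ⊗ₜ[ℂ] f j := by
  obtain ⟨n, x, f, hx, h⟩ := exists_orthonormal_repr (TensorProduct.comm ℂ E F t)
  refine ⟨n, x, f, hx, ?_⟩
  apply (TensorProduct.comm ℂ E F).injective
  simp [h]

lemma norm_sq_sum_tmul_left {n : ℕ} {x : Fin n → E} (hx : Orthonormal ℂ x) (f : Fin n → F) :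
    ‖∑ j, x j ⊗ₜ[ℂ] f j‖ ^ 2 = ∑ j, ‖f j‖ ^ 2 := by
  rw [← norm_sq_sum_tmul hx f, ← TensorProduct.norm_comm]
  simp

lemma norm_sq_sum_htmul_left {n : ℕ} {x : Fin n → E} (hx : Orthonormal ℂ x) (f : Fin n → F) :
    ‖∑ j, tmul (x j) (f j)‖ ^ 2 = ∑ j, ‖f j‖ ^ 2 := by
  rw [← norm_sq_sum_tmul_left hx f, ← UniformSpace.Completion.norm_coe (∑ j, x j ⊗ₜ[ℂ] f j)]
  exact congrArg (‖·‖ ^ 2) (map_sum (UniformSpace.Completion.toComplL (𝕜 := ℂ))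
    (fun j => x j ⊗ₜ[ℂ] f j) Finset.univ).symm

lemma norm_tensorLift_le {f : E →ₗ[ℂ] (F →L[ℂ] G)} {C : ℝ} (hC : 0 ≤ C) (hf : IsRowBound f C)
    (t : E ⊗[ℂ] F) :
    ‖TensorProduct.lift (ContinuousLinearMap.coeLM ℂ ∘ₗ f) t‖ ≤ C * ‖t‖ := by
  obtain ⟨n, x, h, hx, rfl⟩ := exists_orthonormal_left_repr t
  refine le_of_sq_le_sq ?_ (by positivity)
  rw [mul_pow, norm_sq_sum_tmul_left hx, map_sum]
  simpa using hf n x hx h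

/-- The bounded operator `E ⊗ F → G`, `x ⊗ y ↦ f x y`. -/
noncomputable def lift [CompleteSpace G] (f : E →ₗ[ℂ] (F →L[ℂ] G)) {C : ℝ} (hC : 0 ≤ C)
    (hf : IsRowBound f C) : HTensor E F →L[ℂ] G :=
  ((TensorProduct.lift (ContinuousLinearMap.coeLM ℂ ∘ₗ f)).mkContinuous C
    (norm_tensorLift_le hC hf)).extend UniformSpace.Completion.toComplL

lemma lift_coe [CompleteSpace G] (f : E →ₗ[ℂ] (F →L[ℂ] G)) {C : ℝ} (hC : 0 ≤ C)
    (hf : IsRowBound f C)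
    (t : E ⊗[ℂ] F) : lift f hC hf (t : HTensor E F) =
      TensorProduct.lift (ContinuousLinearMap.coeLM ℂ ∘ₗ f) t := by
  exact ContinuousLinearMap.extend_eq _ UniformSpace.Completion.denseRange_coe
    (UniformSpace.Completion.isUniformInducing_coe _) t

@[simp] lemma lift_tmul [CompleteSpace G] (f : E →ₗ[ℂ] (F →L[ℂ] G)) {C : ℝ} (hC : 0 ≤ C)
    (hf : IsRowBound f C)
    (x : E) (y : F) : lift f hC hf (tmul x y) = f x y := by
  rw [tmul, lift_coe]; simp

lemma norm_lift_le [CompleteSpace G] (f : E →ₗ[ℂ] (F →L[ℂ] G)) {C : ℝ} (hC : 0 ≤ C)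
    (hf : IsRowBound f C) :
    ‖lift f hC hf‖ ≤ C := by
  refine ContinuousLinearMap.opNorm_le_bound _ hC fun u => ?_
  induction u using UniformSpace.Completion.induction_on with
  | hp => exact isClosed_le (lift f hC hf).continuous.norm (continuous_const.mul continuous_norm)
  | ih t =>
    rw [lift_coe, UniformSpace.Completion.norm_coe]
    exact norm_tensorLift_le hC hf t

/-- `I_E ⊗ B` for a bounded operator `B`. -/
noncomputable def lampl (E : Type*) [NormedAddCommGroup E] [InnerProductSpace ℂ E]
    (B : F →L[ℂ] L) : HTensor E F →L[ℂ] HTensor E L :=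
  lift ((ContinuousLinearMap.compL ℂ F L (HTensor E L)).flip B ∘ₗ tmulLeft L) (norm_nonneg B)
    (fun N x hx h => by
      simp only [LinearMap.comp_apply, ContinuousLinearMap.coe_coe,
        ContinuousLinearMap.flip_apply, ContinuousLinearMap.compL_apply,
        ContinuousLinearMap.comp_apply, tmulLeft_apply]
      rw [norm_sq_sum_htmul_left hx, Finset.mul_sum]
      refine Finset.sum_le_sum fun j _ => ?_
      rw [← mul_pow]
      exact pow_le_pow_left₀ (norm_nonneg _) (B.le_opNorm _) 2)

lemma lampl_tmul (B : F →L[ℂ] L) (x : E) (y : F) : lampl E B (tmul x y) = tmul x (B y) := by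
  exact lift_tmul _ _ _ x y

lemma norm_lampl_le (B : F →L[ℂ] L) : ‖lampl E B‖ ≤ ‖B‖ := norm_lift_le _ _ _

lemma lmapIsometry_eq_lampl (V : F →ₗᵢ[ℂ] L) :
    lmapIsometry E V = lampl E V.toContinuousLinearMap := by
  refine clm_ext fun x y => ?_
  rw [lampl_tmul, lmapIsometry, tmul, ContinuousLinearMap.completion_apply_coe]
  simp [tmul]

lemma ampl_lampl (A : E →L[ℂ] G) (B : F →L[ℂ] L) :
    ampl L A ∘L lampl E B = lampl G B ∘L ampl F A :=
  clm_ext fun x y => by simp [ampl_tmul, lampl_tmul]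

lemma ampl_id : ampl F (ContinuousLinearMap.id ℂ E) = ContinuousLinearMap.id ℂ _ :=
  clm_ext fun x y => by simp [ampl_tmul]

lemma ampl_zero : ampl F (0 : E →L[ℂ] G) = 0 := clm_ext fun x y => by
  rw [ampl_tmul, zero_apply, zero_apply,
    ← zero_smul ℂ (0 : G), smul_tmul, zero_smul]

lemma ampl_comp {G' : Type*} [NormedAddCommGroup G'] [InnerProductSpace ℂ G'] (A : E →L[ℂ] G)
    (B : G →L[ℂ] G') : ampl F (B ∘L A) = ampl F B ∘L ampl F A :=
  clm_ext fun x y => by simp [ampl_tmul]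

lemma lampl_id :
    lampl E (ContinuousLinearMap.id ℂ F) = ContinuousLinearMap.id ℂ _ :=
  clm_ext fun x y => by simp [lampl_tmul]

lemma lampl_comp (A : F →L[ℂ] G) (B : G →L[ℂ] L) :
    lampl E (B ∘L A) = lampl E B ∘L lampl E A :=
  clm_ext fun x y => by simp [lampl_tmul]

lemma lampl_sub (A B : F →L[ℂ] L) : lampl E (A - B) = lampl E A - lampl E B :=
  clm_ext fun x y => by
    rw [sub_apply, lampl_tmul, lampl_tmul, lampl_tmul, sub_apply,
      ← tmulLeft_apply, map_sub]; rfl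

open ContinuousLinearMap (adjoint adjoint_inner_left)

lemma adjoint_ampl [CompleteSpace E] [CompleteSpace G] (A : E →L[ℂ] G) :
    adjoint (ampl F A) = ampl F (adjoint A) := by
  refine clm_ext fun z w => ext_inner_right ℂ fun v => ?_
  have : innerSL ℂ (adjoint (ampl F A) (tmul z w)) = innerSL ℂ (ampl F (adjoint A) (tmul z w)) :=
    clm_ext fun x y => by
      simp [adjoint_inner_left, ampl_tmul, inner_tmul]
  exact DFunLike.congr_fun this v

lemma adjoint_lampl [CompleteSpace F] [CompleteSpace L] (B : F →L[ℂ] L) :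
    adjoint (lampl E B) = lampl E (adjoint B) := by
  refine clm_ext fun z w => ext_inner_right ℂ fun v => ?_
  have : innerSL ℂ (adjoint (lampl E B) (tmul z w)) = innerSL ℂ (lampl E (adjoint B) (tmul z w)) :=
    clm_ext fun x y => by
      simp [adjoint_inner_left, lampl_tmul, inner_tmul]
  exact DFunLike.congr_fun this v

/-- Bounded operators on `E ⊗ (F ⊗ G)` are determined by their values on elementary tensors. -/
lemma clm_ext_right {A B : HTensor E (HTensor F G) →L[ℂ] L}
    (h : ∀ x y z, A (tmul x (tmul y z)) = B (tmul x (tmul y z))) : A = B := by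
  refine clm_ext fun x u => ?_
  have : A ∘L tmulLeft _ x = B ∘L tmulLeft _ x := clm_ext fun y z => h x y z
  exact DFunLike.congr_fun this u

/-- Bounded operators on `(E ⊗ F) ⊗ G` are determined by their values on elementary tensors. -/
lemma clm_ext_left {A B : HTensor (HTensor E F) G →L[ℂ] L}
    (h : ∀ x y z, A (tmul (tmul x y) z) = B (tmul (tmul x y) z)) : A = B := by
  refine clm_ext fun u z => ?_
  have : A ∘L tmulRight _ z = B ∘L tmulRight _ z := clm_ext fun x y => h x y z
  exact DFunLike.congr_fun this u

/-- The operators `x j ⊗ ·` with orthonormal `x j` have orthogonal ranges. -/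
lemma norm_sq_sum_ampl_tmulLeft [CompleteSpace F] {n : ℕ} {x : Fin n → E} (hx : Orthonormal ℂ x)
    (u : Fin n → HTensor F G) :
    ‖∑ j, ampl G (tmulLeft F (x j)) (u j)‖ ^ 2 = ∑ j, ‖u j‖ ^ 2 := by
  have h1 : ∀ i j, adjoint (tmulLeft F (x i)) ∘L tmulLeft F (x j) =
      (if i = j then (1 : ℂ) else 0) • ContinuousLinearMap.id ℂ F := by
    intro i j
    ext y
    refine ext_inner_right ℂ fun w => ?_
    rw [ContinuousLinearMap.comp_apply, adjoint_inner_left, tmulLeft_apply, tmulLeft_apply,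
      inner_tmul, orthonormal_iff_ite.mp hx, smul_apply, inner_smul_left]
    rcases eq_or_ne i j with rfl | h
    · simp
    · simp [h, h.symm]
  have h2 : ∀ i j, inner ℂ (ampl G (tmulLeft F (x i)) (u i)) (ampl G (tmulLeft F (x j)) (u j)) =
      if i = j then inner ℂ (u i) (u i) else 0 := by
    intro i j
    rw [← ContinuousLinearMap.adjoint_inner_right, adjoint_ampl, ← ContinuousLinearMap.comp_apply,
      ← ampl_comp, h1]
    split_ifs with h
    · subst h; simp [ampl_id]
    · simp [ampl_zero]
  have h3 : (inner ℂ (∑ j, ampl G (tmulLeft F (x j)) (u j))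
      (∑ j, ampl G (tmulLeft F (x j)) (u j)) : ℂ) = ((∑ j, ‖u j‖ ^ 2 : ℝ) : ℂ) := by
    simp only [sum_inner, inner_sum, h2]
    simp [inner_self_eq_norm_sq_to_K]
  rw [inner_self_eq_norm_sq_to_K] at h3
  exact Complex.ofReal_injective ((Complex.ofReal_pow _ _).trans h3)

/-- The associativity unitary `E ⊗ (F ⊗ G) → (E ⊗ F) ⊗ G`. -/
noncomputable def assocL (E F G : Type*) [NormedAddCommGroup E] [InnerProductSpace ℂ E]
    [NormedAddCommGroup F] [InnerProductSpace ℂ F] [CompleteSpace F]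
    [NormedAddCommGroup G] [InnerProductSpace ℂ G] :
    HTensor E (HTensor F G) →L[ℂ] HTensor (HTensor E F) G :=
  lift { toFun := fun x => ampl G (tmulLeft F x)
         map_add' := fun x y => by rw [map_add, ampl_add]
         map_smul' := fun c x => by rw [map_smul, ampl_smul, RingHom.id_apply] } zero_le_one
    (fun N x hx u => by
      simpa using (norm_sq_sum_ampl_tmulLeft hx u).le)

@[simp] lemma assocL_tmul [CompleteSpace F] (x : E) (y : F) (z : G) :
    assocL E F G (tmul x (tmul y z)) = tmul (tmul x y) z := by
  exact (lift_tmul _ _ _ x _).trans (ampl_tmul _ y z)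

lemma norm_assocL_le [CompleteSpace F] : ‖assocL E F G‖ ≤ 1 := norm_lift_le _ _ _

lemma adjoint_assocL_comp [CompleteSpace F] :
    adjoint (assocL E F G) ∘L assocL E F G = ContinuousLinearMap.id ℂ _ := by
  refine clm_ext_right fun x y z => ext_inner_right ℂ fun v => ?_
  have : innerSL ℂ ((adjoint (assocL E F G) ∘L assocL E F G) (tmul x (tmul y z))) =
      innerSL ℂ (tmul x (tmul y z)) :=
    clm_ext_right fun x' y' z' => by
      simp [adjoint_inner_left, inner_tmul, mul_assoc]
  exact DFunLike.congr_fun this v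

lemma assocL_comp_adjoint [CompleteSpace F] :
    assocL E F G ∘L adjoint (assocL E F G) = ContinuousLinearMap.id ℂ _ := by
  refine clm_ext_left fun x y z => ?_
  have := DFunLike.congr_fun (adjoint_assocL_comp (E := E) (F := F) (G := G)) (tmul x (tmul y z))
  simp only [ContinuousLinearMap.comp_apply, assocL_tmul, ContinuousLinearMap.id_apply] at this ⊢
  rw [this, assocL_tmul]

end HTensor

/-! ### Complete boundedness and row operators -/

section CBBound

open HTensor

variable {E H : Type*} [NormedAddCommGroup E] [InnerProductSpace ℂ E]
  [NormedAddCommGroup H] [InnerProductSpace ℂ H]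

lemma blockOp_apply {V W : Type*} [NormedAddCommGroup V] [InnerProductSpace ℂ V]
    [NormedAddCommGroup W] [InnerProductSpace ℂ W] {N : ℕ}
    (A : Matrix (Fin N) (Fin N) (V →L[ℂ] W)) (v : PiLp 2 (fun _ : Fin N => V)) (i : Fin N) :
    blockOp A v i = ∑ j, A i j (v j) := by
  simp [blockOp]

lemma columnMatrixNorm_nonneg {N : ℕ} (x : Matrix (Fin N) (Fin N) E) : 0 ≤ columnMatrixNorm x := by
  unfold columnMatrixNorm
  positivity

/-- The column operator `ℂᴺ → Eᴺ` with matrix `x` is bounded by `columnMatrixNorm x`. -/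
lemma sum_norm_sq_smul_le {N : ℕ} (x : Matrix (Fin N) (Fin N) E) (c : Fin N → ℂ) :
    ∑ i, ‖∑ j, c j • x i j‖ ^ 2 ≤ columnMatrixNorm x ^ 2 * ∑ j, ‖c j‖ ^ 2 := by
  have h := (blockOp (x.map fun e => ContinuousLinearMap.toSpanSingleton ℂ e)).le_opNorm
    (WithLp.toLp 2 c)
  have h2 := pow_le_pow_left₀ (norm_nonneg _) h 2
  rw [mul_pow, PiLp.norm_sq_eq_of_L2, PiLp.norm_sq_eq_of_L2] at h2
  simpa [blockOp_apply, columnMatrixNorm] using h2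

/-- The column operator `Hᴺ → (E ⊗ H)ᴺ` with matrix `x` is bounded by `columnMatrixNorm x`: in
coordinates for an orthonormal basis of the span of the `v j`, it is a direct sum of copies of the
operator `ℂᴺ → Eᴺ`. -/
lemma sum_norm_sq_tmul_le {N : ℕ} (x : Matrix (Fin N) (Fin N) E) (v : Fin N → H) :
    ∑ i, ‖∑ j, x i j ⊗ₜ[ℂ] v j‖ ^ 2 ≤ columnMatrixNorm x ^ 2 * ∑ j, ‖v j‖ ^ 2 := by
  let W := Submodule.span ℂ (Set.range v)
  have : FiniteDimensional ℂ W := FiniteDimensional.span_of_finite ℂ (Set.finite_range v)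
  let b := stdOrthonormalBasis ℂ W
  have hb : Orthonormal ℂ (fun l => (b l : H)) := b.orthonormal.comp_linearIsometry W.subtypeₗᵢ
  let w : Fin N → W := fun j => ⟨v j, Submodule.subset_span ⟨j, rfl⟩⟩
  have hv : ∀ j, v j = ∑ l, (b.repr (w j) l) • (b l : H) := fun j => by
    have := congrArg W.subtype (b.sum_repr (w j))
    simpa [w] using this.symm
  have hn : ∀ j, ‖v j‖ ^ 2 = ∑ l, ‖b.repr (w j) l‖ ^ 2 := fun j => by
    rw [← PiLp.norm_sq_eq_of_L2, b.repr.norm_map]; rfl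
  have h1 : ∀ i, ∑ j, x i j ⊗ₜ[ℂ] v j = ∑ l, (∑ j, b.repr (w j) l • x i j) ⊗ₜ[ℂ] (b l : H) := by
    intro i
    calc ∑ j, x i j ⊗ₜ[ℂ] v j = ∑ j, ∑ l, (b.repr (w j) l • x i j) ⊗ₜ[ℂ] (b l : H) :=
          Finset.sum_congr rfl fun j _ => by
            conv_lhs => rw [hv j]
            simp only [TensorProduct.tmul_sum, TensorProduct.smul_tmul]
      _ = _ := by rw [Finset.sum_comm]; simp only [TensorProduct.sum_tmul]
  simp only [h1, norm_sq_sum_tmul hb, hn]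
  rw [Finset.sum_comm, Finset.sum_comm (γ := Fin N), Finset.mul_sum]
  exact Finset.sum_le_sum fun l _ => sum_norm_sq_smul_le x _

lemma IsTilde.isRowBound {T : E →ₗ[ℂ] (H →L[ℂ] H)} {Tt : HTensor E H →L[ℂ] H}
    (h : IsTilde T Tt) {C : ℝ} (hC : ‖Tt‖ ≤ C) : IsRowBound T C := by
  intro N x hx v
  rw [← norm_sq_sum_htmul_left hx, ← mul_pow]
  simp_rw [← h _ _]
  rw [← map_sum]
  exact pow_le_pow_left₀ (norm_nonneg _) (Tt.le_of_opNorm_le hC _) 2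

/-- On the column Hilbert space `E`, complete boundedness with constant `C` is boundedness by `C`
of all the row operators with orthonormal entries. -/
lemma isCBBound_iff_isRowBound {T : E →ₗ[ℂ] (H →L[ℂ] H)} {C : ℝ} (hC : 0 ≤ C) :
    IsCBBound T C ↔ IsRowBound T C := by
  constructor
  · intro h N x hx v
    rcases N with _ | n
    · simp
    -- the square matrix with first row `x` and all other rows zero
    let A : Matrix (Fin (n + 1)) (Fin (n + 1)) E := fun i j => if i = 0 then x j else 0
    have hA0 : ∀ j, A 0 j = x j := fun j => if_pos rfl
    have hA1 : ∀ i j, i ≠ 0 → A i j = 0 := fun i j hi => if_neg hi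
    have hA : columnMatrixNorm A ≤ 1 := by
      refine ContinuousLinearMap.opNorm_le_bound _ zero_le_one fun c => ?_
      refine le_of_sq_le_sq ?_ (by positivity)
      rw [one_mul, PiLp.norm_sq_eq_of_L2, PiLp.norm_sq_eq_of_L2, Finset.sum_eq_single 0]
      · have h2 : ‖∑ j, c j • x j‖ ^ 2 = ∑ j, ‖c j‖ ^ 2 := by
          have := hx.inner_sum (fun j => c j) (fun j => c j) Finset.univ
          rw [inner_self_eq_norm_sq_to_K] at this
          apply Complex.ofReal_injective
          rw [Complex.ofReal_pow]
          refine this.trans ?_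
          push_cast
          exact Finset.sum_congr rfl fun j _ => by
            rw [← Complex.conj_mul']
        simpa [blockOp_apply, hA0] using h2.le
      · intro i _ hi
        simp [blockOp_apply, hA1 i _ hi]
      · simp
    have h1 := (blockOp (A.map T)).le_of_opNorm_le
      ((h (n + 1) A).trans (mul_le_of_le_one_right hC hA)) (WithLp.toLp 2 v)
    have h2 := (PiLp.norm_apply_le (blockOp (A.map T) (WithLp.toLp 2 v)) 0).trans h1
    have h3 := pow_le_pow_left₀ (norm_nonneg _) h2 2
    rw [mul_pow, PiLp.norm_sq_eq_of_L2] at h3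
    simpa [blockOp_apply, hA0] using h3
  · intro h N x
    refine ContinuousLinearMap.opNorm_le_bound _
      (mul_nonneg hC (columnMatrixNorm_nonneg x)) fun v => ?_
    refine le_of_sq_le_sq ?_
      (mul_nonneg (mul_nonneg hC (columnMatrixNorm_nonneg x)) (norm_nonneg _))
    rw [mul_pow, mul_pow, PiLp.norm_sq_eq_of_L2, PiLp.norm_sq_eq_of_L2, mul_assoc]
    refine le_trans ?_ (mul_le_mul_of_nonneg_left (sum_norm_sq_tmul_le x v) (sq_nonneg C))
    rw [Finset.mul_sum]
    refine Finset.sum_le_sum fun i _ => ?_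
    have h1 := norm_tensorLift_le hC h (∑ j, x i j ⊗ₜ[ℂ] v j)
    rw [map_sum] at h1
    have h2 := pow_le_pow_left₀ (norm_nonneg _) h1 2
    rw [mul_pow] at h2
    simpa [blockOp_apply] using h2

lemma IsCBBound.mono {T : E →ₗ[ℂ] (H →L[ℂ] H)} {C D : ℝ} (h : IsCBBound T C) (hCD : C ≤ D) :
    IsCBBound T D := fun N x =>
  (h N x).trans (mul_le_mul_of_nonneg_right hCD (columnMatrixNorm_nonneg x))

lemma cbNorm_nonneg (T : E →ₗ[ℂ] (H →L[ℂ] H)) : 0 ≤ cbNorm T :=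
  Real.sInf_nonneg fun _ h => h.1

lemma cbNorm_le {T : E →ₗ[ℂ] (H →L[ℂ] H)} {C : ℝ} (hC : 0 ≤ C) (h : IsCBBound T C) :
    cbNorm T ≤ C :=
  csInf_le ⟨0, fun _ h => h.1⟩ ⟨hC, h⟩

lemma IsCompletelyBounded.exists_isTilde [CompleteSpace H] {T : E →ₗ[ℂ] (H →L[ℂ] H)}
    (hT : IsCompletelyBounded T) {r : ℝ} (hr : cbNorm T < r) :
    ∃ Tt : HTensor E H →L[ℂ] H, IsTilde T Tt ∧ ‖Tt‖ < r := by
  obtain ⟨C, hC⟩ := hT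
  have hne : {C : ℝ | 0 ≤ C ∧ IsCBBound T C}.Nonempty :=
    ⟨max C 0, le_max_right _ _, hC.mono (le_max_left _ _)⟩
  obtain ⟨D, ⟨hD0, hD⟩, hDr⟩ := exists_lt_of_csInf_lt hne hr
  have hD' := (isCBBound_iff_isRowBound hD0).mp hD
  exact ⟨lift T hD0 hD', lift_tmul T hD0 hD', (norm_lift_le T hD0 hD').trans_lt hDr⟩

end CBBound

/-! ### Isometric embeddings and the defect operator -/

section Embedding

/-- A separable Hilbert space embeds isometrically into every infinite-dimensional one. -/
lemma exists_linearIsometry_of_separable {H K : Type*} [NormedAddCommGroup H]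
    [InnerProductSpace ℂ H] [CompleteSpace H] [TopologicalSpace.SeparableSpace H]
    [NormedAddCommGroup K] [InnerProductSpace ℂ K] [CompleteSpace K]
    (hK : ¬ FiniteDimensional ℂ K) : Nonempty (H →ₗᵢ[ℂ] K) := by
  obtain ⟨w, b, hb⟩ := exists_hilbertBasis ℂ H
  obtain ⟨v, d, hd⟩ := exists_hilbertBasis ℂ K
  -- distinct basis vectors are at distance `√2`, which forces a basis of `H` to be countable
  have hdist : ∀ i j : w, i ≠ j → Real.sqrt 2 ≤ dist (b i) (b j) := by
    intro i j hij
    rw [dist_eq_norm]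
    refine Real.sqrt_le_iff.mpr ⟨norm_nonneg _, ?_⟩
    have := norm_sub_sq (𝕜 := ℂ) (b i) (b j)
    rw [b.orthonormal.2 hij, b.orthonormal.1, b.orthonormal.1] at this
    norm_num at this
    rw [this]
  have hw : Countable w := by
    have hr : (0 : ℝ) < Real.sqrt 2 / 2 := by positivity
    refine Pairwise.countable_of_isOpen_disjoint (s := fun i : w => Metric.ball (b i) (√2 / 2))
      ?_ (fun i => Metric.isOpen_ball) (fun i => Metric.nonempty_ball.mpr hr)
    intro i j hij
    refine Metric.ball_disjoint_ball ?_
    have := hdist i j hij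
    linarith
  have hv : Infinite v := by
    by_contra hfin
    rw [not_infinite_iff_finite] at hfin
    have := Fintype.ofFinite v
    exact hK d.toOrthonormalBasis.toBasis.finiteDimensional_of_finite
  have : Nonempty (w ↪ v) := by
    obtain ⟨f, hf⟩ := exists_injective_nat w
    exact ⟨(⟨f, hf⟩ : w ↪ ℕ).trans (Infinite.natEmbedding v)⟩
  obtain ⟨e⟩ := this
  have ho := (d.orthonormal.comp e e.injective).orthogonalFamily
  exact ⟨ho.linearIsometry.comp b.repr.toLinearIsometry⟩

/-- For a contraction `A : E → H`, the defect `I - A A*` factors as `B B*` through any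
infinite-dimensional Hilbert space, provided that `H` is separable. -/
lemma exists_defect {E H K : Type*} [NormedAddCommGroup E] [InnerProductSpace ℂ E]
    [CompleteSpace E] [NormedAddCommGroup H]
    [InnerProductSpace ℂ H] [CompleteSpace H] [TopologicalSpace.SeparableSpace H]
    [NormedAddCommGroup K] [InnerProductSpace ℂ K] [CompleteSpace K]
    (hK : ¬ FiniteDimensional ℂ K) (A : E →L[ℂ] H) (hA : ‖A‖ ≤ 1) :
    ∃ B : K →L[ℂ] H, B ∘L ContinuousLinearMap.adjoint B =
      ContinuousLinearMap.id ℂ H - A ∘L ContinuousLinearMap.adjoint A := by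
  obtain ⟨J⟩ := exists_linearIsometry_of_separable (H := H) hK
  have hpos : 0 ≤ ContinuousLinearMap.id ℂ H - A ∘L ContinuousLinearMap.adjoint A := by
    rw [ContinuousLinearMap.nonneg_iff_isPositive, ContinuousLinearMap.isPositive_iff_complex]
    intro h
    have h1 : (inner ℂ ((ContinuousLinearMap.id ℂ H - A ∘L ContinuousLinearMap.adjoint A) h) h
        : ℂ) = ((‖h‖ ^ 2 - ‖ContinuousLinearMap.adjoint A h‖ ^ 2 : ℝ) : ℂ) := by
      rw [sub_apply, inner_sub_left, ContinuousLinearMap.comp_apply,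
        ← ContinuousLinearMap.adjoint_inner_right A, inner_self_eq_norm_sq_to_K,
        ContinuousLinearMap.id_apply, inner_self_eq_norm_sq_to_K]
      push_cast; rfl
    have h2 : ‖ContinuousLinearMap.adjoint A h‖ ≤ ‖h‖ := by
      have := (ContinuousLinearMap.adjoint A).le_of_opNorm_le
        ((LinearIsometryEquiv.norm_map _ A).trans_le hA) h
      rwa [one_mul] at this
    rw [h1]
    refine ⟨rfl, ?_⟩
    rw [RCLike.re_eq_complex_re, Complex.ofReal_re, sub_nonneg]
    exact pow_le_pow_left₀ (norm_nonneg _) h2 2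
  set D := CFC.sqrt (ContinuousLinearMap.id ℂ H - A ∘L ContinuousLinearMap.adjoint A) with hD
  have hDD : D * D = _ := CFC.sqrt_mul_sqrt_self _ hpos
  have hDs : ContinuousLinearMap.adjoint D = D := (CFC.sqrt_nonneg _).isSelfAdjoint
  refine ⟨D ∘L ContinuousLinearMap.adjoint J.toContinuousLinearMap, ?_⟩
  rw [← hDD, ContinuousLinearMap.adjoint_comp, ContinuousLinearMap.adjoint_adjoint, hDs]
  have hJ : ContinuousLinearMap.adjoint J.toContinuousLinearMap ∘L J.toContinuousLinearMap =
      ContinuousLinearMap.id ℂ H :=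
    (ContinuousLinearMap.norm_map_iff_adjoint_comp_self _).mp J.norm_map
  ext h
  have := DFunLike.congr_fun hJ (D h)
  simp only [ContinuousLinearMap.comp_apply, ContinuousLinearMap.id_apply] at this
  simp only [ContinuousLinearMap.comp_apply, this]
  rfl

end Embedding

/-! ### The operators of the shift and of its inflations -/

namespace SubproductSystem

open HTensor ContinuousLinearMap

variable {X : ℕ → Type*} [∀ n, NormedAddCommGroup (X n)] [∀ n, InnerProductSpace ℂ (X n)]
  [∀ n, CompleteSpace (X n)] (P : SubproductSystem X)

lemma norm_U_le {m n k : ℕ} (h : m + n = k) : ‖P.U h‖ ≤ 1 := by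
  have h1 : ‖adjoint (P.U h)‖ * ‖adjoint (P.U h)‖ ≤ 1 := by
    rw [← norm_adjoint_comp_self, adjoint_adjoint, P.coisometric h]
    exact norm_id_le
  rw [LinearIsometryEquiv.norm_map] at h1
  nlinarith [norm_nonneg (P.U h)]

/-- The coordinate map of the Fock space onto `X n`. -/
noncomputable def proj (n : ℕ) : P.Fock →L[ℂ] X n :=
  LinearMap.mkContinuous
    { toFun := fun ξ => ξ n
      map_add' := fun _ _ => rfl
      map_smul' := fun _ _ => rfl } 1
    (fun ξ => by rw [one_mul]; exact lp.norm_apply_le_norm two_ne_zero ξ n)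

@[simp] lemma proj_apply (n : ℕ) (ξ : P.Fock) : P.proj n ξ = ξ n := rfl

lemma norm_proj_le (n : ℕ) : ‖P.proj n‖ ≤ 1 := LinearMap.mkContinuous_norm_le _ zero_le_one _

lemma adjoint_proj_apply (n : ℕ) (x : X n) : adjoint (P.proj n) x = lp.single 2 n x := by
  refine ext_inner_right ℂ fun ξ => ?_
  rw [adjoint_inner_left, lp.inner_single_left, proj_apply]

lemma norm_sq_fock (ξ : P.Fock) : HasSum (fun n => ‖ξ n‖ ^ 2) (‖ξ‖ ^ 2) := by
  simpa using lp.hasSum_norm (p := 2) (by norm_num) ξ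

@[simp] lemma shift_apply {m : ℕ} (x : X m) (ξ : P.Fock) (k : ℕ) :
    P.shift m x ξ k = P.shiftFun x ξ k := rfl

/-- The operator `X n ⊗ 𝔉 → 𝔉` of the shift is a contraction. -/
lemma isRowBound_shift (n : ℕ) : IsRowBound (P.shift n) 1 := by
  intro N x hx ξ
  set η : P.Fock := ∑ j, P.shift n (x j) (ξ j) with hη
  have hk : ∀ k, η k = ∑ j, P.shiftFun (x j) (ξ j) k := by
    intro k
    rw [hη, ← proj_apply, map_sum]; rfl
  have h0 : ∀ k < n, η k = 0 := fun k hk' => by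
    rw [hk]; exact Finset.sum_eq_zero fun j _ => P.shiftFun_of_lt _ _ hk'
  have h1 : ∀ m, ‖η (m + n)‖ ^ 2 ≤ ∑ j, ‖ξ j m‖ ^ 2 := by
    intro m
    rw [hk, ← norm_sq_sum_htmul_left hx, Nat.add_comm m n]
    simp_rw [shiftFun_add]
    rw [← map_sum (P.U (rfl : n + m = n + m))]
    have := (P.U (rfl : n + m = n + m)).le_of_opNorm_le (P.norm_U_le rfl)
      (∑ j, tmul (x j) (ξ j m))
    rw [one_mul] at this
    exact pow_le_pow_left₀ (norm_nonneg _) this 2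
  have h2 : HasSum (fun m => ‖η (m + n)‖ ^ 2) (‖η‖ ^ 2) := by
    refine (hasSum_nat_add_iff (f := fun k => ‖η k‖ ^ 2) n).mpr ?_
    rw [Finset.sum_eq_zero, add_zero]
    · exact P.norm_sq_fock η
    · intro k hk'
      rw [h0 k (Finset.mem_range.mp hk')]; simp
  rw [one_pow, one_mul]
  exact hasSum_le h1 h2 (hasSum_sum fun j _ => P.norm_sq_fock (ξ j))

/-- The scaled inflation of the shift has bounded operators `X n ⊗ (𝔉 ⊗ K) → 𝔉 ⊗ K`. -/
lemma exists_isTilde_scaledInflation (K : Type*) [NormedAddCommGroup K] [InnerProductSpace ℂ K]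
    (r : ℝ) (n : ℕ) : ∃ Rt : HTensor (X n) (HTensor P.Fock K) →L[ℂ] HTensor P.Fock K,
      IsTilde (P.scaledInflation K r n) Rt ∧ ‖Rt‖ ≤ |r| ^ n := by
  let St := lift (P.shift n) zero_le_one (P.isRowBound_shift n)
  have hSt : ‖St‖ ≤ 1 := norm_lift_le _ _ _
  refine ⟨(r : ℂ) ^ n • (ampl K St ∘L assocL (X n) P.Fock K), ?_, ?_⟩
  · intro x u
    have : ((r : ℂ) ^ n • (ampl K St ∘L assocL (X n) P.Fock K)) ∘L tmulLeft _ x =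
        P.scaledInflation K r n x := clm_ext fun ξ k => by
      change (r : ℂ) ^ n • ampl K St (assocL (X n) P.Fock K (tmul x (tmul ξ k))) =
        (r : ℂ) ^ n • ampl K (P.shift n x) (tmul ξ k)
      rw [assocL_tmul, ampl_tmul, ampl_tmul, lift_tmul]
    exact DFunLike.congr_fun this u
  · refine (opNorm_smul_le _ _).trans ?_
    rw [norm_pow, Complex.norm_real, Real.norm_eq_abs]
    refine mul_le_of_le_one_right (by positivity) ?_
    refine (opNorm_comp_le _ _).trans ?_
    exact mul_le_one₀ ((norm_ampl_le _).trans hSt) (norm_nonneg _) norm_assocL_le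

end SubproductSystem

lemma IsTilde.unique {E H : Type*} [NormedAddCommGroup E] [InnerProductSpace ℂ E]
    [NormedAddCommGroup H] [InnerProductSpace ℂ H] {T : E →ₗ[ℂ] (H →L[ℂ] H)}
    {A B : HTensor E H →L[ℂ] H} (hA : IsTilde T A) (hB : IsTilde T B) : A = B :=
  HTensor.clm_ext fun x h => (hA x h).trans (hB x h).symm

lemma ContinuousLinearMap.summable_of_norm_le_pow {E F : Type*} [NormedAddCommGroup E]
    [NormedSpace ℂ E] [NormedAddCommGroup F] [NormedSpace ℂ F] [CompleteSpace F]
    {f : ℕ → E →L[ℂ] F} {c : ℝ} (h0 : 0 ≤ c) (h1 : c < 1) (hf : ∀ n, ‖f n‖ ≤ c ^ n) :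
    Summable f :=
  Summable.of_norm_bounded (summable_geometric_of_lt_one h0 h1) hf

namespace SubproductSystem

open HTensor ContinuousLinearMap

variable {X : ℕ → Type*} [∀ n, NormedAddCommGroup (X n)] [∀ n, InnerProductSpace ℂ (X n)]
  [∀ n, CompleteSpace (X n)] (P : SubproductSystem X)
  {H : Type*} [NormedAddCommGroup H] [InnerProductSpace ℂ H]

/-! ### Pieces of a family -/

/-- If `T` is a piece of a family whose operator on `X 1` has norm at most `r`, then the row
operators of `T` on `X 1` are bounded by `r`. -/
lemma isRowBound_of_isUnitarilyEquivalentToPiece {L : Type*} [NormedAddCommGroup L]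
    [InnerProductSpace ℂ L] [CompleteSpace L] {T : P.Family H} {R : P.Family L} {n : ℕ} {r : ℝ}
    {Rt : HTensor (X n) L →L[ℂ] L} (hRt : IsTilde (R n) Rt) (hr : ‖Rt‖ ≤ r)
    (h : P.IsUnitarilyEquivalentToPiece T R) : IsRowBound (T n) r := by
  obtain ⟨M, hM, S, W, hS, hW⟩ := h
  obtain ⟨St, Tt, hSt, hTt, hadj⟩ := hS n
  obtain rfl := hTt.unique hRt
  have hV : adjoint (lmapIsometry (X n) M.subtypeₗᵢ) ∘L lmapIsometry (X n) M.subtypeₗᵢ =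
      ContinuousLinearMap.id ℂ _ := by
    rw [lmapIsometry_eq_lampl, adjoint_lampl, ← lampl_comp,
      (norm_map_iff_adjoint_comp_self _).mp M.subtypeₗᵢ.norm_map]
    exact lampl_id
  have hnorm : ‖St‖ ≤ r := by
    rw [← LinearIsometryEquiv.norm_map adjoint]
    refine opNorm_le_bound _ ((opNorm_nonneg _).trans hr) fun h => ?_
    rw [← (norm_map_iff_adjoint_comp_self _).mpr hV, ← hadj]
    exact le_of_opNorm_le _ ((LinearIsometryEquiv.norm_map adjoint Tt).trans_le hr) _
  intro N x hx h
  have := hSt.isRowBound hnorm N x hx (fun j => W (h j))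
  simp_rw [← hW, ← map_sum, W.norm_map] at this
  exact this

/-! ### The Poisson kernel -/

/-- The associativity relation of a representation, in terms of the operators
`X n ⊗ H → H`: the composite of `Ãₖ` with the coisometry `X m ⊗ (X n ⊗ H) → X k ⊗ H` given by
the multiplication is `Ãₘ (I ⊗ Ãₙ)`. -/
lemma tilde_mul {A : P.Family H} {m n k : ℕ} (hmn : m + n = k)
    (hmul : ∀ (x : X m) (y : X n), A k (P.U hmn (tmul x y)) = A m x ∘L A n y)
    {Am : HTensor (X m) H →L[ℂ] H} {An : HTensor (X n) H →L[ℂ] H} {Ak : HTensor (X k) H →L[ℂ] H}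
    (hm : IsTilde (A m) Am) (hn : IsTilde (A n) An) (hk : IsTilde (A k) Ak) :
    Ak ∘L (ampl H (P.U hmn) ∘L assocL (X m) (X n) H) = Am ∘L lampl (X m) An := by
  refine clm_ext_right fun x y h => ?_
  simp only [ContinuousLinearMap.comp_apply, assocL_tmul, ampl_tmul, lampl_tmul]
  rw [hk, hmul, hn, hm]; rfl

lemma ampl_U_assocL_coisometric {m n k : ℕ} (hmn : m + n = k) :
    (ampl H (P.U hmn) ∘L assocL (X m) (X n) H) ∘L
      adjoint (ampl H (P.U hmn) ∘L assocL (X m) (X n) H) = ContinuousLinearMap.id ℂ _ := by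
  rw [adjoint_comp, comp_assoc, ← comp_assoc (assocL (X m) (X n) H), assocL_comp_adjoint, id_comp,
    adjoint_ampl, ← ampl_comp, P.coisometric, ampl_id]

/-- `Ãₖ Ãₖ* = Ãₘ (I ⊗ Ãₙ Ãₙ*) Ãₘ*`, because the multiplication is coisometric. -/
lemma tilde_comp_adjoint [CompleteSpace H] {A : P.Family H} {m n k : ℕ} (hmn : m + n = k)
    (hmul : ∀ (x : X m) (y : X n), A k (P.U hmn (tmul x y)) = A m x ∘L A n y)
    {Am : HTensor (X m) H →L[ℂ] H} {An : HTensor (X n) H →L[ℂ] H} {Ak : HTensor (X k) H →L[ℂ] H}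
    (hm : IsTilde (A m) Am) (hn : IsTilde (A n) An) (hk : IsTilde (A k) Ak) :
    Ak ∘L adjoint Ak = Am ∘L lampl (X m) (An ∘L adjoint An) ∘L adjoint Am := by
  have h := P.tilde_mul hmn hmul hm hn hk
  set Z := ampl H (P.U hmn) ∘L assocL (X m) (X n) H with hZ
  have hZZ : Z ∘L adjoint Z = ContinuousLinearMap.id ℂ _ := P.ampl_U_assocL_coisometric hmn
  calc Ak ∘L adjoint Ak = Ak ∘L (Z ∘L adjoint Z) ∘L adjoint Ak := by rw [hZZ, id_comp]
    _ = (Ak ∘L Z) ∘L adjoint (Ak ∘L Z) := by rw [adjoint_comp Ak Z]; rfl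
    _ = _ := by rw [h, adjoint_comp, adjoint_lampl, lampl_comp]; rfl

lemma norm_tilde_le_mul [CompleteSpace H] {A : P.Family H} {m n k : ℕ} (hmn : m + n = k)
    (hmul : ∀ (x : X m) (y : X n), A k (P.U hmn (tmul x y)) = A m x ∘L A n y)
    {Am : HTensor (X m) H →L[ℂ] H} {An : HTensor (X n) H →L[ℂ] H} {Ak : HTensor (X k) H →L[ℂ] H}
    (hm : IsTilde (A m) Am) (hn : IsTilde (A n) An) (hk : IsTilde (A k) Ak) :
    ‖Ak‖ ≤ ‖Am‖ * ‖An‖ := by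
  have h := P.tilde_mul hmn hmul hm hn hk
  set Z := ampl H (P.U hmn) ∘L assocL (X m) (X n) H with hZ
  have hZZ : Z ∘L adjoint Z = ContinuousLinearMap.id ℂ _ := P.ampl_U_assocL_coisometric hmn
  have hZ1 : ‖adjoint Z‖ ≤ 1 := by
    rw [LinearIsometryEquiv.norm_map]
    exact (opNorm_comp_le _ _).trans (mul_le_one₀ ((norm_ampl_le _).trans (P.norm_U_le hmn))
      (norm_nonneg _) norm_assocL_le)
  have hA : Ak = (Am ∘L lampl (X m) An) ∘L adjoint Z := by
    rw [← h, comp_assoc, hZZ, comp_id]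
  rw [hA]
  refine (opNorm_comp_le _ _).trans ?_
  refine (mul_le_of_le_one_right (norm_nonneg _) hZ1).trans ?_
  refine (opNorm_comp_le _ _).trans ?_
  gcongr
  exact norm_lampl_le An

/-- A representation `A` of `P` on `H` with the associated operators `At n : X n ⊗ H → H`, the one
on `X 1` having norm less than one. Complete boundedness of `A` is encoded by the existence of the
bounded operators `At n`. -/
structure StrictlyContractive (A : P.Family H) (At : ∀ n, HTensor (X n) H →L[ℂ] H) : Prop where
  scalar : ∀ c : ℂ, A 0 (P.scalar c) = c • ContinuousLinearMap.id ℂ H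
  mul : ∀ {m n k : ℕ} (h : m + n = k) (x : X m) (y : X n),
    A k (P.U h (tmul x y)) = A m x ∘L A n y
  tilde : ∀ n, IsTilde (A n) (At n)
  norm_lt : ‖At 1‖ < 1

namespace StrictlyContractive

variable {P} [CompleteSpace H] {A : P.Family H} {At : ∀ n, HTensor (X n) H →L[ℂ] H}

lemma adjoint_tilde_zero (hA : P.StrictlyContractive A At) (h : H) :
    adjoint (At 0) h = tmul (P.scalar 1) h := by
  refine ext_inner_right ℂ fun u => ?_
  have : innerSL ℂ (adjoint (At 0) h) = innerSL ℂ (tmul (P.scalar 1) h) :=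
    clm_ext fun x y => by
      obtain ⟨c, rfl⟩ := P.scalar.surjective x
      simp only [innerSL_apply_apply]
      rw [adjoint_inner_left, hA.tilde, hA.scalar, inner_tmul, P.scalar.inner_map_map]
      simp [inner_smul_right]
  exact DFunLike.congr_fun this u

lemma zero_comp_adjoint (hA : P.StrictlyContractive A At) :
    At 0 ∘L adjoint (At 0) = ContinuousLinearMap.id ℂ H := by
  ext h
  rw [ContinuousLinearMap.comp_apply, hA.adjoint_tilde_zero, hA.tilde, hA.scalar, one_smul]

lemma norm_le (hA : P.StrictlyContractive A At) (n : ℕ) : ‖At n‖ ≤ ‖At 1‖ ^ n := by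
  induction n with
  | zero =>
    have h := norm_adjoint_comp_self (adjoint (At 0))
    rw [adjoint_adjoint, hA.zero_comp_adjoint, LinearIsometryEquiv.norm_map] at h
    have h1 : ‖ContinuousLinearMap.id ℂ H‖ ≤ 1 := norm_id_le
    rw [pow_zero]
    nlinarith [norm_nonneg (At 0)]
  | succ n ih =>
    rw [pow_succ]
    exact (P.norm_tilde_le_mul rfl (hA.mul rfl) (hA.tilde n) (hA.tilde 1) (hA.tilde _)).trans
      (mul_le_mul_of_nonneg_right ih (opNorm_nonneg _))

lemma summable (hA : P.StrictlyContractive A At) :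
    Summable fun n => At n ∘L ampl H (P.proj n) := by
  have hb : ∀ n, ‖At n ∘L ampl H (P.proj n)‖ ≤ ‖At 1‖ ^ n := fun n =>
    (opNorm_comp_le _ _).trans ((mul_le_of_le_one_right (opNorm_nonneg _)
      ((norm_ampl_le _).trans (P.norm_proj_le n))).trans (hA.norm_le n))
  exact summable_of_norm_le_pow (opNorm_nonneg (At 1)) hA.norm_lt hb

end StrictlyContractive

/-- The operator `𝔉 ⊗ H → H`, `ξ ⊗ h ↦ ∑ A n (ξ n) h`, given the operators `At n : X n ⊗ H → H`
of `A`. -/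
noncomputable def fockTilde (At : ∀ n, HTensor (X n) H →L[ℂ] H) : HTensor P.Fock H →L[ℂ] H :=
  ∑' n, At n ∘L ampl H (P.proj n)

namespace StrictlyContractive

variable {P} [CompleteSpace H] {A : P.Family H} {At : ∀ n, HTensor (X n) H →L[ℂ] H}

lemma hasSum_fockTilde (hA : P.StrictlyContractive A At) (u : HTensor P.Fock H) :
    HasSum (fun n => At n (ampl H (P.proj n) u)) (P.fockTilde At u) :=
  hA.summable.hasSum.mapL (ContinuousLinearMap.apply ℂ H u)

lemma hasSum_fockTilde_tmul (hA : P.StrictlyContractive A At) (ξ : P.Fock) (h : H) :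
    HasSum (fun n => A n (ξ n) h) (P.fockTilde At (tmul ξ h)) := by
  have := hA.hasSum_fockTilde (tmul ξ h)
  simp_rw [ampl_tmul, hA.tilde _ _] at this
  exact this

/-- The operator `ξ ⊗ h ↦ ∑ A n (ξ n) h` intertwines the inflated shift with `A`. -/
lemma fockTilde_shift (hA : P.StrictlyContractive A At) {n : ℕ} (x : X n) :
    P.fockTilde At ∘L ampl H (P.shift n x) = A n x ∘L P.fockTilde At := by
  refine clm_ext fun ξ h => ?_
  rw [ContinuousLinearMap.comp_apply, ContinuousLinearMap.comp_apply, ampl_tmul]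
  have h1 := hA.hasSum_fockTilde_tmul (P.shift n x ξ) h
  have h2 := (hA.hasSum_fockTilde_tmul ξ h).mapL (A n x)
  rw [← hasSum_nat_add_iff' n, Finset.sum_eq_zero, sub_zero] at h1
  · refine h1.unique ?_
    convert h2 using 2 with m
    rw [Nat.add_comm m n, shift_apply, shiftFun_add, hA.mul]; rfl
  · intro k hk
    rw [shift_apply, P.shiftFun_of_lt _ _ (Finset.mem_range.mp hk), map_zero, zero_apply]

/-- The component of the adjoint of `fockTilde At` in `X n ⊗ H` is `Ãₙ*`. -/
lemma ampl_proj_adjoint_fockTilde (hA : P.StrictlyContractive A At) (n : ℕ) :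
    ampl H (P.proj n) ∘L adjoint (P.fockTilde At) = adjoint (At n) := by
  have : P.fockTilde At ∘L ampl H (adjoint (P.proj n)) = At n := clm_ext fun x h => by
    rw [ContinuousLinearMap.comp_apply, ampl_tmul, hA.tilde, adjoint_proj_apply]
    refine (hA.hasSum_fockTilde_tmul _ h).unique ?_
    convert hasSum_single n ?_ using 1
    · rw [lp.single_apply_self]
    · intro m hm
      rw [lp.single_apply_ne _ _ _ hm, map_zero, zero_apply]
  rw [← this, adjoint_comp, adjoint_ampl, adjoint_adjoint]

/-- The adjoint of the Poisson kernel is a coisometry: the sum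
`∑ Ãₙ (I ⊗ B B*) Ãₙ*` telescopes. -/
lemma poisson_coisometric (hA : P.StrictlyContractive A At) {K : Type*} [NormedAddCommGroup K]
    [InnerProductSpace ℂ K] [CompleteSpace K] {B : K →L[ℂ] H}
    (hB : B ∘L adjoint B = ContinuousLinearMap.id ℂ H - At 1 ∘L adjoint (At 1)) :
    (P.fockTilde At ∘L lampl P.Fock B) ∘L adjoint (P.fockTilde At ∘L lampl P.Fock B) =
      ContinuousLinearMap.id ℂ H := by
  ext h
  have h1 : (P.fockTilde At ∘L lampl P.Fock B) ∘L adjoint (P.fockTilde At ∘L lampl P.Fock B) =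
      P.fockTilde At ∘L lampl P.Fock (B ∘L adjoint B) ∘L adjoint (P.fockTilde At) := by
    rw [adjoint_comp, adjoint_lampl, lampl_comp]; rfl
  have hterm : ∀ n, At n ∘L ampl H (P.proj n) ∘L lampl P.Fock (B ∘L adjoint B) ∘L
      adjoint (P.fockTilde At) =
      At n ∘L adjoint (At n) - At (n + 1) ∘L adjoint (At (n + 1)) := by
    intro n
    rw [← comp_assoc (ampl H (P.proj n)), ampl_lampl, comp_assoc, hA.ampl_proj_adjoint_fockTilde,
      P.tilde_comp_adjoint rfl (hA.mul rfl) (hA.tilde n) (hA.tilde 1) (hA.tilde (n + 1)), hB,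
      lampl_sub, lampl_id, sub_comp, comp_sub, id_comp]
  have hsum : HasSum (fun n => (At n ∘L adjoint (At n)) h -
      (At (n + 1) ∘L adjoint (At (n + 1))) h) ((P.fockTilde At ∘L
        lampl P.Fock (B ∘L adjoint B) ∘L adjoint (P.fockTilde At)) h) := by
    have := hA.hasSum_fockTilde (lampl P.Fock (B ∘L adjoint B) (adjoint (P.fockTilde At) h))
    have hn : ∀ n, (At n ∘L adjoint (At n)) h - (At (n + 1) ∘L adjoint (At (n + 1))) h =
        At n (ampl H (P.proj n) (lampl P.Fock (B ∘L adjoint B) (adjoint (P.fockTilde At) h))) :=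
      fun n => (DFunLike.congr_fun (hterm n) h).symm
    simp_rw [hn]
    exact this
  have hlim : Filter.Tendsto (fun n => (At n ∘L adjoint (At n)) h) Filter.atTop (nhds 0) := by
    have hpow := (tendsto_pow_atTop_nhds_zero_of_lt_one (norm_nonneg (At 1)) hA.norm_lt)
    have hpow2 := (hpow.mul hpow).mul_const ‖h‖
    rw [mul_zero, zero_mul] at hpow2
    refine squeeze_zero_norm (fun n => ?_) hpow2
    refine le_of_opNorm_le _ ((opNorm_comp_le _ _).trans ?_) h
    rw [LinearIsometryEquiv.norm_map]
    exact mul_le_mul (hA.norm_le n) (hA.norm_le n) (norm_nonneg _) (by positivity)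
  have htel := hsum.tendsto_sum_nat
  simp_rw [Finset.sum_range_sub' (fun n => (At n ∘L adjoint (At n)) h)] at htel
  have hlim2 := hlim.const_sub ((At 0 ∘L adjoint (At 0)) h)
  rw [h1, tendsto_nhds_unique htel hlim2, hA.zero_comp_adjoint, sub_zero]

end StrictlyContractive

/-- A coisometry `V : L → H` intertwining `R` with `T` realises `T` as a piece of `R`, on the range
of the isometry `V*`. -/
lemma isUnitarilyEquivalentToPiece_of_coisometry [CompleteSpace H] {L : Type*}
    [NormedAddCommGroup L] [InnerProductSpace ℂ L] [CompleteSpace L]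
    {T : P.Family H} {R : P.Family L} (hT : ∀ n, ∃ Tt, IsTilde (T n) Tt) (hR : ∀ n, ∃ Rt, IsTilde (R n) Rt)
    (V : L →L[ℂ] H) (hV : V ∘L adjoint V = ContinuousLinearMap.id ℂ H)
    (hVR : ∀ n (x : X n), V ∘L R n x = T n x ∘L V) : P.IsUnitarilyEquivalentToPiece T R := by
  let J : H →ₗᵢ[ℂ] L := ⟨(adjoint V : H →ₗ[ℂ] L), fun h =>
    (norm_map_iff_adjoint_comp_self (adjoint V)).mpr (by rw [adjoint_adjoint]; exact hV) h⟩
  let M : Submodule ℂ L := LinearMap.range J.toLinearMap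
  have hM : CompleteSpace M := by
    have : IsComplete (M : Set L) := by
      have := J.isometry.isUniformInducing.isComplete_range
      rwa [show (M : Set L) = Set.range J from LinearMap.coe_range _]
    exact this.completeSpace_coe
  let W : H ≃ₗᵢ[ℂ] M := J.equivRange
  have hW : ∀ h, (W h : L) = adjoint V h := fun h => rfl
  let Wc : H →L[ℂ] M := W.toContinuousLinearEquiv.toContinuousLinearMap
  let Wi : M →L[ℂ] H := W.symm.toContinuousLinearEquiv.toContinuousLinearMap
  have hWc : adjoint Wc = Wi := by
    refine ((eq_adjoint_iff Wi Wc).mpr fun m h => ?_).symm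
    obtain ⟨g, rfl⟩ := W.surjective m
    change inner ℂ (W.symm (W g)) h = inner ℂ (W g) (W h)
    rw [W.symm_apply_apply, W.inner_map_map]
  let S : P.Family M := fun n =>
    { toFun := fun x => Wc ∘L T n x ∘L Wi
      map_add' := fun x y => by ext; simp
      map_smul' := fun c x => by ext; simp }
  refine ⟨M, hM, S, W, fun n => ?_, fun n x h => ?_⟩
  · obtain ⟨Tt, hTt⟩ := hT n
    obtain ⟨Rt, hRt⟩ := hR n
    refine ⟨Wc ∘L Tt ∘L lampl (X n) Wi, Rt, ?_, hRt, ?_⟩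
    · intro x m
      simp only [ContinuousLinearMap.comp_apply, lampl_tmul]
      rw [hTt]; rfl
    · intro m
      obtain ⟨h, rfl⟩ := W.surjective m
      have hint : V ∘L Rt = Tt ∘L lampl (X n) V := clm_ext fun x u => by
        simp only [ContinuousLinearMap.comp_apply, lampl_tmul]
        rw [hTt, hRt]
        exact DFunLike.congr_fun (hVR n x) u
      have hint' := DFunLike.congr_fun (congrArg adjoint hint) h
      rw [adjoint_comp, adjoint_comp, adjoint_lampl] at hint'
      have hWW : Wi (W h) = h := W.symm_apply_apply h
      have hsub : M.subtypeₗᵢ.toContinuousLinearMap ∘L Wc = adjoint V := rfl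
      rw [hW, lmapIsometry_eq_lampl, adjoint_comp, adjoint_comp, adjoint_lampl, hWc,
        ← hWc, adjoint_adjoint, hWc, ContinuousLinearMap.comp_apply,
        ContinuousLinearMap.comp_apply, hWW]
      rw [← hsub, lampl_comp] at hint'
      exact hint'
  · change W (T n x h) = W (T n x (W.symm (W h)))
    rw [W.symm_apply_apply]

end SubproductSystem

/-! ### Dilation and the norm of a piece -/

namespace SubproductSystem

open HTensor ContinuousLinearMap

variable {X : ℕ → Type*} [∀ n, NormedAddCommGroup (X n)] [∀ n, InnerProductSpace ℂ (X n)]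
  [∀ n, CompleteSpace (X n)] {P : SubproductSystem X}
  {H : Type*} [NormedAddCommGroup H] [InnerProductSpace ℂ H]

lemma IsCBRepresentation.strictlyContractive {T : P.Family H} (hT : P.IsCBRepresentation T)
    {Tt : ∀ n, HTensor (X n) H →L[ℂ] H} (hTt : ∀ n, IsTilde (T n) (Tt n)) {r : ℝ} (hr : 0 < r)
    (hTr : ‖Tt 1‖ < r) :
    P.StrictlyContractive (fun n => (r⁻¹ : ℂ) ^ n • T n) (fun n => (r⁻¹ : ℂ) ^ n • Tt n) where
  scalar c := by simp [hT.scalar c]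
  mul := by
    rintro m n k rfl x y
    simp only [LinearMap.smul_apply]
    rw [hT.mul rfl, smul_comp, comp_smul, smul_smul, pow_add]
  tilde n x h := by
    rw [smul_apply, hTt]; rfl
  norm_lt := by
    refine (opNorm_smul_le _ _).trans_lt ?_
    rw [pow_one, norm_inv, Complex.norm_real, Real.norm_of_nonneg hr.le]
    exact (inv_mul_lt_one₀ hr).mpr hTr

/-- The dilation: the adjoint of the Poisson kernel of `r⁻¹ T` intertwines `S ⊗ rI_K` with `T`. -/
lemma IsCBRepresentation.isUnitarilyEquivalentToPiece [CompleteSpace H]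
    [TopologicalSpace.SeparableSpace H] {T : P.Family H} (hT : P.IsCBRepresentation T)
    {K : Type*} [NormedAddCommGroup K] [InnerProductSpace ℂ K] [CompleteSpace K]
    (hK : ¬ FiniteDimensional ℂ K) {r : ℝ} (hr : P.repCBNorm T < r) :
    P.IsUnitarilyEquivalentToPiece T (P.scaledInflation K r) := by
  have hr0 : 0 < r := (cbNorm_nonneg _).trans_lt hr
  choose Tt hTt _ using fun n => (hT.completelyBounded n).exists_isTilde (lt_add_one _)
  obtain ⟨T₁, hT₁, hlt⟩ := (hT.completelyBounded 1).exists_isTilde hr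
  obtain rfl := hT₁.unique (hTt 1)
  have hA := hT.strictlyContractive hTt hr0 hlt
  obtain ⟨B, hB⟩ := exists_defect hK _ hA.norm_lt.le
  refine P.isUnitarilyEquivalentToPiece_of_coisometry (fun n => ⟨Tt n, hTt n⟩)
    (fun n => (P.exists_isTilde_scaledInflation K r n).imp fun _ h => h.1) _
    (hA.poisson_coisometric hB) fun n x => ?_
  change _ ∘L ((r : ℂ) ^ n • ampl K (P.shift n x)) = _
  rw [comp_smul, comp_assoc, ← ampl_lampl, ← comp_assoc, hA.fockTilde_shift, LinearMap.smul_apply,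
    smul_comp, smul_comp, smul_smul, ← mul_pow, mul_inv_cancel₀ (by exact_mod_cast hr0.ne'),
    one_pow, one_smul, comp_assoc]

/-- A representation that is a piece of `S ⊗ rI_K` has completely bounded norm at most `r`. -/
lemma repCBNorm_le {T : P.Family H} {K : Type*} [NormedAddCommGroup K] [InnerProductSpace ℂ K]
    {r : ℝ} (hr : 0 ≤ r) (h : P.IsUnitarilyEquivalentToPiece T (P.scaledInflation K r)) :
    P.repCBNorm T ≤ r := by
  obtain ⟨Rt, hRt, hn⟩ := P.exists_isTilde_scaledInflation K r 1
  rw [pow_one, abs_of_nonneg hr] at hn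
  exact cbNorm_le hr ((isCBBound_iff_isRowBound hr).mpr
    (P.isRowBound_of_isUnitarilyEquivalentToPiece hRt hn h))

end SubproductSystem

theorem mainTheorem8 {X : ℕ → Type*} [∀ n, NormedAddCommGroup (X n)]
    [∀ n, InnerProductSpace ℂ (X n)] [∀ n, CompleteSpace (X n)] (P : SubproductSystem X)
    {H : Type*} [NormedAddCommGroup H] [InnerProductSpace ℂ H] [CompleteSpace H]
    [TopologicalSpace.SeparableSpace H]
    (T : P.Family H) (hT : P.IsCBRepresentation T)
    {K : Type*} [NormedAddCommGroup K] [InnerProductSpace ℂ K] [CompleteSpace K]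
    [TopologicalSpace.SeparableSpace K] (hK : ¬ FiniteDimensional ℂ K) :
    (∀ r : ℝ, P.repCBNorm T < r →
      P.IsUnitarilyEquivalentToPiece T (P.scaledInflation K r)) ∧
    IsGLB {r : ℝ | 0 < r ∧ P.IsUnitarilyEquivalentToPiece T (P.scaledInflation K r)}
      (P.repCBNorm T) := by
  refine ⟨fun r hr => hT.isUnitarilyEquivalentToPiece hK hr,
    fun r hr => SubproductSystem.repCBNorm_le hr.1.le hr.2, fun b hb => ?_⟩
  -- every `r > ‖T‖_cb` lies in the set, so a lower bound of the set is at most `‖T‖_cb`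
  refine le_of_forall_gt_imp_ge_of_dense fun r hr => ?_
  exact hb ⟨(cbNorm_nonneg _).trans_lt hr, hT.isUnitarilyEquivalentToPiece hK hr⟩
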